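/- Call a real Banach space $V$ \emph{Rosenthal} if it does not contain an isomorphic copy of $\ell_1$, i.e. if there is no continuous linear map $\ell_1 \to V$ that is a homeomorphism onto its image. Call a compact Hausdorff space $X$ \emph{weakly Radon--Nikod\'ym} (WRN) if there exist a Rosenthal Banach space $V$ and a topological embedding of $X$ into the dual $V^*$ equipped with its weak$^*$ topology (since the image of a compact space is bounded, it is equivalent to ask for an embedding into the dual unit ball $(B_{V^*}, w^*)$). \textbf{Theorem.} The Stone--\v{C}ech compactification $\beta\mathbb{N}$ of the discrete space $\mathbb{N}$ is not WRN. That is, for no real Banach space $V$ not containing an isomorphic copy of $\ell_1$ is there a topological embedding of $\beta\mathbb{N}$ into $(V^*, w^*)$. -/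

import Mathlib

universe u v

/-- A real normed space (in practice a Banach space) `V` is *Rosenthal* if it contains no isomorphic
copy of `ℓ¹`, i.e. no continuous linear map `ℓ¹ → V` is a homeomorphism onto its image. -/
def IsRosenthalSpace (V : Type v) [NormedAddCommGroup V] [NormedSpace ℝ V] : Prop :=
  ¬ ∃ T : lp (fun _ : ℕ => ℝ) 1 →L[ℝ] V, Topology.IsEmbedding T

/-- A compact Hausdorff space `X` is *weakly Radon–Nikodým* (WRN) if it is homeomorphic to a
subspace of `(V*, weak*)` for some real Banach space `V` not containing `ℓ¹`. (The image of a compact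
space is automatically bounded, so after rescaling it lies in the dual unit ball.) The Banach space
ranges over the universe `v`. -/
def IsWRN (X : Type u) [TopologicalSpace X] [CompactSpace X] [T2Space X] : Prop :=
  ∃ (V : Type v) (_ : NormedAddCommGroup V) (_ : NormedSpace ℝ V) (_ : CompleteSpace V),
    IsRosenthalSpace V ∧ ∃ α : X → WeakDual ℝ V, Topology.IsEmbedding α

/-! Map `βℕ` onto a power of `Bool` with uncountably many coordinates. Given an embedding `α` into
`V*`, compactness separates the two fibres of each coordinate by finitely many ball vectors with
rational gaps; by pigeonhole infinitely many coordinates share the same gaps. As `V` has no `ℓ¹`,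
`exists_independentPairs_or_converges` thins these so that, for each gap, no point is infinitely
often on both sides. Surjectivity gives infinitely many points with prescribed, disjoint infinite
sets of true coordinates. Two of them behave alike at every gap, so eventually no gap separates
them, although infinitely many coordinates do. -/

open Filter

/-! ### Ramsey theorem for open sets, via an ultrafilter game -/

/-- The positions from which a player choosing numbers along `𝒰`-large sets can force the play
into `O`. -/
inductive UltraWin (𝒰 : Filter ℕ) (O : List ℕ → Prop) : List ℕ → Prop
  | base {s : List ℕ} (h : O s) : UltraWin 𝒰 O s
  | step {s : List ℕ} (A : Set ℕ) (hA : A ∈ 𝒰) (h : ∀ n ∈ A, UltraWin 𝒰 O (s ++ [n])) :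
      UltraWin 𝒰 O s

/-- A winning position admits a strategy: large sets of moves all of whose plays reach `O`. -/
theorem UltraWin.exists_strategy {𝒰 : Filter ℕ} {O : List ℕ → Prop} {s : List ℕ}
    (hs : UltraWin 𝒰 O s) :
    ∃ g : List ℕ → Set ℕ, (∀ t, g t ∈ 𝒰) ∧ ∀ f : ℕ → ℕ,
      (List.range s.length).map f = s →
      (∀ j, s.length ≤ j → f j ∈ g ((List.range j).map f)) →
        ∃ j, O ((List.range j).map f) := by
  induction hs with
  | @base s h =>
    exact ⟨fun _ => Set.univ, fun _ => univ_mem, fun f hf _ => ⟨s.length, by rwa [hf]⟩⟩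
  | @step s A hA _ ih =>
    have ih' : ∀ n, ∃ g : List ℕ → Set ℕ, (∀ t, g t ∈ 𝒰) ∧ (n ∈ A → ∀ f : ℕ → ℕ,
        (List.range (s ++ [n]).length).map f = s ++ [n] →
        (∀ j, (s ++ [n]).length ≤ j → f j ∈ g ((List.range j).map f)) →
          ∃ j, O ((List.range j).map f)) := by
      intro n
      by_cases hn : n ∈ A
      · obtain ⟨g, hg, hO⟩ := ih n hn
        exact ⟨g, hg, fun _ => hO⟩
      · exact ⟨fun _ => Set.univ, fun _ => univ_mem, fun h => absurd h hn⟩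
    choose G hG hGO using ih'
    -- The entry of `t` at index `s.length` records the first move, hence which strategy to follow.
    refine ⟨fun t => if t.length ≤ s.length then A else G (t.getD s.length 0) t, ?_, ?_⟩
    · intro t
      dsimp only
      split_ifs
      exacts [hA, hG _ _]
    · intro f hf hg
      have h0 : f s.length ∈ A := by simpa using hg s.length le_rfl
      refine hGO (f s.length) h0 f ?_ fun j hj => ?_
      · rw [List.length_append, List.length_singleton, List.range_succ, List.map_append, hf]
        rfl
      · rw [List.length_append, List.length_singleton] at hj
        have h1 := hg j (by omega)
        have h2 : ((List.range j).map f).getD s.length 0 = f s.length := by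
          simp [List.getD, List.getElem?_map, List.getElem?_range (show s.length < j by omega)]
        dsimp only at h1
        rw [if_neg (by simp only [List.length_map, List.length_range]; omega), h2] at h1
        exact h1

/-- Given large sets attached to the finite sequences, some infinite sequence is compatible with
them along all of its subsequences. -/
theorem exists_strictMono_diagonal {𝒰 : Filter ℕ} [𝒰.NeBot] (h𝒰 : 𝒰 ≤ atTop)
    (g : List ℕ → Set ℕ) (hg : ∀ t, g t ∈ 𝒰) :
    ∃ f : ℕ → ℕ, StrictMono f ∧ ∀ h : ℕ → ℕ, StrictMono h → ∀ k,
      f (h k) ∈ g ((List.range k).map (f ∘ h)) := by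
  classical
  have hnext : ∀ p : ℕ × Finset (List ℕ), ∃ n, p.1 < n ∧ ∀ t ∈ p.2, n ∈ g t := by
    intro p
    have h1 : ∀ᶠ n in 𝒰, p.1 < n := h𝒰 (eventually_gt_atTop p.1)
    have h2 : ∀ᶠ n in 𝒰, ∀ t ∈ p.2, n ∈ g t :=
      (Finset.eventually_all p.2).2 fun t _ => hg t
    exact (h1.and h2).exists
  choose next hlt hmem using hnext
  -- The finite set holds all subsequences of the moves so far; the next move must suit each of
  -- them.
  let S : ℕ → ℕ × Finset (List ℕ) := fun k => Nat.rec (0, {[]})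
    (fun _ p => (next p, p.2 ∪ p.2.image fun t => t ++ [next p])) k
  have hS1 : ∀ k, (S (k + 1)).1 = next (S k) := fun _ => rfl
  have hS2 : ∀ k, (S (k + 1)).2 = (S k).2 ∪ (S k).2.image fun t => t ++ [next (S k)] :=
    fun _ => rfl
  have hmono : Monotone fun k => (S k).2 :=
    monotone_nat_of_le_succ fun k => by
      rw [hS2]
      exact Finset.subset_union_left
  have hf : StrictMono fun k => next (S k) := strictMono_nat_of_lt_succ fun k => by
    have := hlt (S (k + 1))
    rwa [hS1] at this
  refine ⟨fun k => next (S k), hf, fun h hh k => ?_⟩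
  have key : ∀ k m, (∀ i < k, h i < m) →
      (List.range k).map ((fun k => next (S k)) ∘ h) ∈ (S m).2 := by
    intro k
    induction k with
    | zero => exact fun m _ => hmono (Nat.zero_le m) (by simp [S])
    | succ k ih =>
      intro m hm
      have h1 := ih (h k) fun i hi => hh hi
      refine hmono (hm k k.lt_succ_self) ?_
      change _ ∈ (S (h k + 1)).2
      rw [hS2, List.range_succ, List.map_append]
      exact Finset.mem_union_right _ (Finset.mem_image.2 ⟨_, h1, rfl⟩)
  exact hmem _ _ (key k (h k) fun i hi => hh hi)

/-- Open subsets of the space of infinite subsets of `ℕ` are Ramsey. -/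
theorem exists_strictMono_forall_not_or_forall_exists (O : List ℕ → Prop) :
    (∃ f : ℕ → ℕ, StrictMono f ∧ ∀ h : ℕ → ℕ, StrictMono h → ∀ k,
      ¬ O ((List.range k).map (f ∘ h))) ∨
    ∃ f : ℕ → ℕ, StrictMono f ∧ ∀ h : ℕ → ℕ, StrictMono h → ∃ k,
      O ((List.range k).map (f ∘ h)) := by
  classical
  have h𝒰 : (hyperfilter ℕ : Filter ℕ) ≤ atTop := Nat.hyperfilter_le_atTop
  by_cases hw : UltraWin (hyperfilter ℕ : Filter ℕ) O []
  · right
    obtain ⟨g, hg, hO⟩ := hw.exists_strategy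
    obtain ⟨f, hf, hfg⟩ := exists_strictMono_diagonal h𝒰 g hg
    exact ⟨f, hf, fun h hh => hO (f ∘ h) rfl fun j _ => hfg h hh j⟩
  · left
    obtain ⟨f, hf, hfg⟩ := exists_strictMono_diagonal h𝒰
      (fun t => {n | ¬ UltraWin (hyperfilter ℕ : Filter ℕ) O t →
        ¬ UltraWin (hyperfilter ℕ : Filter ℕ) O (t ++ [n])}) (fun t => by
        by_cases ht : UltraWin (hyperfilter ℕ : Filter ℕ) O t
        · simp [ht]
        · have : {n | UltraWin (hyperfilter ℕ : Filter ℕ) O (t ++ [n])} ∉ hyperfilter ℕ :=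
            fun hA => ht (.step _ hA fun n hn => hn)
          simpa [ht, Set.compl_def] using Ultrafilter.compl_mem_iff_notMem.2 this)
    refine ⟨f, hf, fun h hh k hk => ?_⟩
    have hnot : ∀ k, ¬ UltraWin (hyperfilter ℕ : Filter ℕ) O ((List.range k).map (f ∘ h)) := by
      intro k
      induction k with
      | zero => exact hw
      | succ k ih =>
        rw [List.range_succ, List.map_append]
        exact hfg h hh k ih
    exact hnot k (.base hk)

/-! ### Independence and Rosenthal's dichotomy -/

/-- A sequence of pairs of sets is independent if every finite choice of one set from each of the
first pairs has a common point. -/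
def IndependentPairs {X : Type*} (L U : ℕ → Set X) : Prop :=
  ∀ (N : ℕ) (σ : ℕ → Bool), ∃ x, ∀ n < N, x ∈ bif σ n then L n else U n

/-- **Rosenthal's dichotomy** for sequences of pairs of sets. -/
theorem exists_independentPairs_or_converges {X : Type*} (L U : ℕ → Set X) :
    (∃ f : ℕ → ℕ, StrictMono f ∧ IndependentPairs (L ∘ f) (U ∘ f)) ∨
    ∃ f : ℕ → ℕ, StrictMono f ∧ ∀ x,
      (∀ᶠ n in atTop, x ∉ L (f n)) ∨ ∀ᶠ n in atTop, x ∉ U (f n) := by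
  let alt : ℕ → ℕ → Set X := fun i n => if Even i then L n else U n
  have hmap : ∀ (f : ℕ → ℕ) (k : ℕ) (x : X),
      (∀ i < ((List.range k).map f).length, x ∈ alt i (((List.range k).map f).getD i 0)) ↔
        ∀ i < k, x ∈ alt i (f i) := by
    intro f k x
    rw [List.length_map, List.length_range]
    refine forall₂_congr fun i hi => ?_
    simp [List.getD, List.getElem?_map, List.getElem?_range hi]
  rcases exists_strictMono_forall_not_or_forall_exists
    (fun t => ¬ ∃ x, ∀ i < t.length, x ∈ alt i (t.getD i 0)) with ⟨f, hf, hO⟩ | ⟨f, hf, hO⟩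
  -- The neighbours `3n` and `3n + 2` are spare: using one or the other puts `3n + 1` at an odd
  -- position (testing `U`) or an even one (testing `L`).
  · refine Or.inl ⟨fun n => f (3 * n + 1), fun m n h => hf (by omega), fun N σ => ?_⟩
    let h : ℕ → ℕ := fun i => 3 * (i / 2) + i % 2 + bif σ (i / 2) then 1 else 0
    have hh : StrictMono h := strictMono_nat_of_lt_succ fun i => by
      rcases Nat.even_or_odd' i with ⟨c, rfl | rfl⟩
      · have h1 : (2 * c + 1) / 2 = c := by omega
        have h2 : (2 * c) / 2 = c := by omega
        simp only [h, h1, h2]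
        omega
      · have h1 : (2 * c + 1 + 1) / 2 = c + 1 := by omega
        have h2 : (2 * c + 1) / 2 = c := by omega
        simp only [h, h1, h2]
        cases σ c <;> cases σ (c + 1) <;> simp <;> omega
    obtain ⟨x, hx⟩ := not_not.1 (hO h hh (2 * N))
    rw [hmap] at hx
    refine ⟨x, fun n hn => ?_⟩
    cases hσ : σ n
    · have h1 := hx (2 * n + 1) (by omega)
      have h2 : (2 * n + 1) / 2 = n := by omega
      have h3 : h (2 * n + 1) = 3 * n + 1 := by
        simp only [h, h2, hσ, cond_false]
        omega
      simpa [alt, h3, Nat.not_even_bit1] using h1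
    · have h1 := hx (2 * n) (by omega)
      have h3 : h (2 * n) = 3 * n + 1 := by simp [h, hσ]
      simpa [alt, h3] using h1
  · refine Or.inr ⟨f, hf, fun x => ?_⟩
    by_contra hcon
    rw [not_or, not_eventually, not_eventually] at hcon
    obtain ⟨h, hh, hx⟩ := extraction_forall_of_frequently
      (P := fun i n => x ∈ alt i (f n)) fun i => by
        by_cases hi : Even i
        · simpa [alt, hi] using hcon.1
        · simpa [alt, hi] using hcon.2
    obtain ⟨k, hk⟩ := hO h hh
    exact hk ⟨x, (hmap _ _ _).2 fun i _ => hx i⟩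

/-! ### Copies of `ℓ¹` -/

/-- The operator `ℓ¹ → V` sending the unit vectors to a bounded sequence. -/
theorem exists_clm_lp_one_hasSum {V : Type*} [NormedAddCommGroup V] [NormedSpace ℝ V]
    [CompleteSpace V] (v : ℕ → V) (hv : ∀ n, ‖v n‖ ≤ 1) :
    ∃ T : lp (fun _ : ℕ => ℝ) 1 →L[ℝ] V, ∀ c, HasSum (fun n => c n • v n) (T c) := by
  have hsn : ∀ c : lp (fun _ : ℕ => ℝ) 1, HasSum (fun n => ‖c n‖) ‖c‖ := fun c => by
    simpa using lp.hasSum_norm (p := 1) (by simp) c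
  have hle : ∀ (c : lp (fun _ : ℕ => ℝ) 1) n, ‖c n • v n‖ ≤ ‖c n‖ := fun c n => by
    rw [norm_smul]
    exact mul_le_of_le_one_right (norm_nonneg _) (hv n)
  have hs : ∀ c : lp (fun _ : ℕ => ℝ) 1, Summable fun n => c n • v n := fun c =>
    Summable.of_norm_bounded (hsn c).summable (hle c)
  refine ⟨LinearMap.mkContinuous
    { toFun := fun c => ∑' n, c n • v n
      map_add' := fun c d => by
        rw [← (hs c).tsum_add (hs d)]
        simp [add_smul]
      map_smul' := fun a c => by
        rw [RingHom.id_apply, ← (hs c).tsum_const_smul a]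
        simp [mul_smul] } 1 fun c => ?_, fun c => (hs c).hasSum⟩
  rw [one_mul]
  exact tsum_of_norm_bounded (hsn c) (hle c)

/-- A bounded sequence in `V` that is independent on a bounded set of functionals spans a copy
of `ℓ¹`. -/
theorem not_isRosenthalSpace_of_independentPairs {V X : Type*} [NormedAddCommGroup V]
    [NormedSpace ℝ V] [CompleteSpace V] (φ : X → StrongDual ℝ V) {C : ℝ} (hC : ∀ x, ‖φ x‖ ≤ C)
    {v : ℕ → V} (hv : ∀ n, ‖v n‖ ≤ 1) {a b : ℝ} (hab : a < b)
    (h : IndependentPairs (fun n => {x | φ x (v n) < a}) (fun n => {x | b < φ x (v n)})) :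
    ¬ IsRosenthalSpace V := by
  obtain ⟨T, hT⟩ := exists_clm_lp_one_hasSum v hv
  have hC0 : 0 ≤ C := by
    obtain ⟨x, -⟩ := h 0 fun _ => true
    exact (norm_nonneg _).trans (hC x)
  have hbound : ∀ c : lp (fun _ : ℕ => ℝ) 1, (b - a) * ‖c‖ ≤ 2 * C * ‖T c‖ := by
    intro c
    have h1 : Tendsto (fun N => ∑ n ∈ Finset.range N, ‖c n‖) atTop (nhds ‖c‖) := by
      have : HasSum (fun n => ‖c n‖) ‖c‖ := by
        simpa using lp.hasSum_norm (p := 1) (by simp) c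
      exact this.tendsto_sum_nat
    refine le_of_tendsto_of_tendsto' (h1.const_mul (b - a))
      ((hT c).tendsto_sum_nat.norm.const_mul (2 * C)) fun N => ?_
    -- Opposite sign choices make each term `c n * (φ x (v n) - φ y (v n))` at least `(b - a) * |c
    -- n|`.
    obtain ⟨x, hx⟩ := h N fun n => decide (c n < 0)
    obtain ⟨y, hy⟩ := h N fun n => !decide (c n < 0)
    calc (b - a) * ∑ n ∈ Finset.range N, ‖c n‖
        ≤ ∑ n ∈ Finset.range N, c n * (φ x (v n) - φ y (v n)) := by
          rw [Finset.mul_sum]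
          refine Finset.sum_le_sum fun n hn => ?_
          have hxn := hx n (Finset.mem_range.1 hn)
          have hyn := hy n (Finset.mem_range.1 hn)
          by_cases hc : c n < 0
          · simp only [hc, decide_true, cond_true, Bool.not_true, cond_false,
              Set.mem_ofPred_eq] at hxn hyn
            rw [Real.norm_eq_abs, abs_of_neg hc]
            nlinarith
          · simp only [hc, decide_false, cond_true, Bool.not_false, cond_false,
              Set.mem_ofPred_eq] at hxn hyn
            rw [Real.norm_eq_abs, abs_of_nonneg (not_lt.1 hc)]
            nlinarith
      _ = (φ x - φ y) (∑ n ∈ Finset.range N, c n • v n) := by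
          rw [map_sum]
          simp
      _ ≤ ‖φ x - φ y‖ * ‖∑ n ∈ Finset.range N, c n • v n‖ :=
          (le_abs_self _).trans ((φ x - φ y).le_opNorm _)
      _ ≤ 2 * C * ‖∑ n ∈ Finset.range N, c n • v n‖ := by
          gcongr
          linarith [norm_sub_le (φ x) (φ y), hC x, hC y]
  refine not_not.2 ⟨T, ?_⟩
  have hanti : AntilipschitzWith (Real.toNNReal (2 * C / (b - a))) T :=
    AddMonoidHomClass.antilipschitz_of_bound T fun c => by
      rw [Real.coe_toNNReal _ (by have := sub_pos.2 hab; positivity), div_mul_eq_mul_div,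
        le_div_iff₀ (sub_pos.2 hab), mul_comm]
      exact hbound c
  exact (hanti.isUniformEmbedding T.uniformContinuous).isEmbedding

/-! ### A dense sequence in the Cantor cube -/

/-- `βℕ` maps continuously onto a product of continuum many two-point spaces. -/
theorem exists_continuous_surjective_stoneCech_nat :
    ∃ e : StoneCech ℕ → (ℕ → Bool) → Bool, Continuous e ∧ Function.Surjective e := by
  classical
  have : Countable (TopologicalSpace.Clopens (ℕ → Bool)) :=
    TopologicalSpace.Clopens.countable_iff_secondCountable.2 inferInstance
  obtain ⟨d, hd⟩ := exists_surjective_nat (TopologicalSpace.Clopens (ℕ → Bool))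
  let g : ℕ → (ℕ → Bool) → Bool := fun n x => decide (x ∈ d n)
  have hg : Continuous g := continuous_of_discreteTopology
  refine ⟨stoneCechExtend hg, continuous_stoneCechExtend hg, ?_⟩
  have hdense : DenseRange g := by
    intro τ
    rw [mem_closure_iff]
    intro o ho hτ
    obtain ⟨F, u, hu, huo⟩ := isOpen_pi_iff.1 ho τ hτ
    -- A basic open set fixes finitely many coordinates, and a clopen set realizes any such pattern.
    obtain ⟨c, hc, hc1, hc0⟩ := exists_clopen_of_closed_subset_open
      (F.finite_toSet.subset (Set.sep_subset _ fun x => τ x = true)).isClosed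
      (F.finite_toSet.subset (Set.sep_subset _ fun x => τ x = false)).isClosed.isOpen_compl
      (fun x hx hx' => by simp_all)
    obtain ⟨n, hn⟩ := hd ⟨c, hc⟩
    refine ⟨g n, huo fun x hx => ?_, n, rfl⟩
    have hgx : g n x = τ x := by
      have hmem : x ∈ d n ↔ x ∈ c := by rw [hn]; rfl
      cases hτx : τ x
      · exact decide_eq_false fun h => hc0 (hmem.1 h) ⟨hx, hτx⟩
      · exact decide_eq_true (hmem.2 (hc1 ⟨hx, hτx⟩))
    rw [hgx]
    exact (hu x hx).2
  rw [← Set.range_eq_univ, ← (isCompact_range (continuous_stoneCechExtend hg)).isClosed.closure_eq]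
  refine (hdense.mono ?_).closure_eq
  rintro _ ⟨n, rfl⟩
  exact ⟨stoneCechUnit n, stoneCechExtend_stoneCechUnit hg n⟩

/-! ### Separation by finitely many vectors and the contradiction -/

/-- Disjoint compact sets in a weak* dual are separated by finitely many vectors of the ball, with
rational gaps. -/
theorem exists_finite_separation {V X : Type*} [NormedAddCommGroup V] [NormedSpace ℝ V]
    [TopologicalSpace X] (α : X → WeakDual ℝ V) (hα : Continuous α)
    (hinj : Function.Injective α) {A B : Set X} (hA : IsCompact A) (hB : IsCompact B)
    (hAB : Disjoint A B) :
    ∃ (k : ℕ) (v : Fin k → V) (r : Fin k → ℚ × ℚ), (∀ j, ‖v j‖ ≤ 1) ∧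
      (∀ j, (r j).1 < (r j).2) ∧
      ∀ x ∈ A, ∀ y ∈ B, ∃ j, α x (v j) < (r j).1 ∧ (r j).2 < α y (v j) := by
  let I := {p : V × ℚ × ℚ // ‖p.1‖ ≤ 1 ∧ p.2.1 < p.2.2}
  let W : I → Set (X × X) := fun p =>
    {z | α z.1 p.1.1 < p.1.2.1 ∧ p.1.2.2 < α z.2 p.1.1}
  have hev : ∀ v : V, Continuous fun x => α x v := fun v => (WeakDual.eval_continuous v).comp hα
  have hW : ∀ p, IsOpen (W p) := fun p =>
    (isOpen_lt ((hev _).comp continuous_fst) continuous_const).inter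
      (isOpen_lt continuous_const ((hev _).comp continuous_snd))
  have hcover : A ×ˢ B ⊆ ⋃ p, W p := by
    rintro ⟨x, y⟩ ⟨hx, hy⟩
    have hne : α x ≠ α y := fun h => Set.disjoint_left.1 hAB hx (hinj h ▸ hy)
    have hv : ∃ v, α x v < α y v := by
      by_contra! hcon
      refine hne (DFunLike.ext _ _ fun v => le_antisymm ?_ (hcon v))
      have := hcon (-v)
      rw [map_neg, map_neg] at this
      linarith
    obtain ⟨v, hv⟩ := hv
    have hv0 : 0 < ‖v‖ := norm_pos_iff.2 fun h => by simp [h] at hv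
    have hv' : α x (‖v‖⁻¹ • v) < α y (‖v‖⁻¹ • v) := by
      rw [map_smul, map_smul]
      exact mul_lt_mul_of_pos_left hv (inv_pos.2 hv0)
    obtain ⟨p, hp1, hp2⟩ := exists_rat_btwn hv'
    obtain ⟨q, hq1, hq2⟩ := exists_rat_btwn hp2
    refine Set.mem_iUnion.2 ⟨⟨(‖v‖⁻¹ • v, p, q), ?_, by exact_mod_cast hq1⟩, hp1, hq2⟩
    simp [norm_smul, hv0.ne']
  obtain ⟨t, ht⟩ := (hA.prod hB).elim_finite_subcover W hW hcover
  let E := t.equivFin.symm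
  refine ⟨t.card, fun j => (E j).1.1.1, fun j => (E j).1.1.2, fun j => (E j).1.2.1,
    fun j => (E j).1.2.2, fun x hx y hy => ?_⟩
  obtain ⟨p, hp, hxy⟩ := Set.mem_iUnion₂.1 (ht (Set.mk_mem_prod hx hy))
  refine ⟨t.equivFin ⟨p, hp⟩, ?_⟩
  simp only [E, Equiv.symm_apply_apply]
  exact hxy

/-- A map from an uncountable type to a countable one has an infinite fibre. -/
theorem exists_injective_nat_const {I K : Type*} [Uncountable I] [Countable K] (κ : I → K) :
    ∃ (c : K) (ι : ℕ → I), Function.Injective ι ∧ ∀ n, κ (ι n) = c := by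
  have : ∃ c, (κ ⁻¹' {c}).Infinite := by
    by_contra! hcon
    refine Set.not_countable_univ (α := I) ?_
    have : (Set.univ : Set I) = ⋃ c, κ ⁻¹' {c} := by ext; simp
    rw [this]
    exact Set.countable_iUnion fun c => (hcon c).countable
  obtain ⟨c, hc⟩ := this
  exact ⟨c, fun n => hc.natEmbedding _ n, Subtype.val_injective.comp (hc.natEmbedding _).injective,
    fun n => (hc.natEmbedding _ n).2⟩

/-- A compact space mapping continuously onto an uncountable power of the two-point space does not
embed into the weak* dual of a Rosenthal space. -/
theorem not_injective_weakDual_of_surjective {V X I : Type*} [NormedAddCommGroup V]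
    [NormedSpace ℝ V] [CompleteSpace V] (hV : IsRosenthalSpace V) [TopologicalSpace X]
    [CompactSpace X] [Uncountable I] {e : X → I → Bool} (he : Continuous e)
    (hsurj : Function.Surjective e) {α : X → WeakDual ℝ V} (hα : Continuous α) :
    ¬ Function.Injective α := by
  intro hinj
  obtain ⟨C, hC⟩ : ∃ C, ∀ x, ‖WeakDual.toStrongDual (α x)‖ ≤ C :=
    banach_steinhaus fun v => by
      obtain ⟨C, hC⟩ :=
        (isCompact_range ((WeakDual.eval_continuous v).comp hα)).isBounded.exists_norm_le
      exact ⟨C, fun x => hC _ ⟨x, rfl⟩⟩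
  have hclosed : ∀ (i : I) (β : Bool), IsCompact {x | e x i = β} := fun i β =>
    (isClosed_eq ((continuous_apply i).comp he) continuous_const).isCompact
  choose k v r hv hr hsep using fun i => exists_finite_separation α hα hinj (hclosed i true)
    (hclosed i false) (Set.disjoint_left.2 fun x hx hx' => by simp_all)
  obtain ⟨⟨K, R⟩, ι, hι, hκ⟩ :=
    exists_injective_nat_const (fun i => (⟨k i, r i⟩ : Σ k : ℕ, Fin k → ℚ × ℚ))
  have hdata : ∀ n, ∃ w : Fin K → V, (∀ j, ‖w j‖ ≤ 1) ∧ (∀ j, (R j).1 < (R j).2) ∧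
      ∀ x y, e x (ι n) = true → e y (ι n) = false →
        ∃ j, α x (w j) < (R j).1 ∧ (R j).2 < α y (w j) := by
    intro n
    have h1 := hκ n
    have h2 := hv (ι n)
    have h3 := hr (ι n)
    have h4 := hsep (ι n)
    generalize v (ι n) = w at *
    generalize r (ι n) = r' at *
    generalize k (ι n) = k' at *
    cases h1
    exact ⟨w, h2, h3, fun x y hx hy => h4 x hx y hy⟩
  choose w hw hR hsepw using hdata
  let L : Fin K → ℕ → Set X := fun j n => {x | α x (w n j) < (R j).1}
  let U : Fin K → ℕ → Set X := fun j n => {x | (R j).2 < α x (w n j)}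
  have hconv : ∀ s : Finset (Fin K), ∃ f : ℕ → ℕ, StrictMono f ∧ ∀ j ∈ s, ∀ x,
      (∀ᶠ n in atTop, x ∉ L j (f n)) ∨ ∀ᶠ n in atTop, x ∉ U j (f n) := by
    intro s
    induction s using Finset.induction_on with
    | empty => exact ⟨id, strictMono_id, by simp⟩
    | insert j s _ ih =>
      obtain ⟨f, hf, hfs⟩ := ih
      rcases exists_independentPairs_or_converges (L j ∘ f) (U j ∘ f) with
        ⟨g, hg, hind⟩ | ⟨g, hg, hgx⟩
      · exact absurd hV (not_isRosenthalSpace_of_independentPairs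
          (fun x => WeakDual.toStrongDual (α x)) hC (v := fun n => w (f (g n)) j)
          (fun n => hw _ j) (Rat.cast_lt.2 (hR 0 j)) hind)
      · refine ⟨f ∘ g, hf.comp hg, fun i hi x => ?_⟩
        rcases Finset.mem_insert.1 hi with rfl | hi
        · exact hgx x
        · exact (hfs i hi x).imp (fun h => hg.tendsto_atTop.eventually h)
            fun h => hg.tendsto_atTop.eventually h
  obtain ⟨f, hf, hfx⟩ := hconv Finset.univ
  -- Unpairing splits `ℕ` into infinitely many infinite classes, one for each point `x m`.
  have hpts : ∀ m : ℕ, ∃ x, ∀ n, e x (ι (f n)) = decide (n.unpair.1 = m) := fun m => by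
    obtain ⟨x, hx⟩ := hsurj
      (Function.extend (ι ∘ f) (fun n => decide (n.unpair.1 = m)) fun _ => false)
    refine ⟨x, fun n => ?_⟩
    rw [hx]
    exact (hι.comp hf.injective).extend_apply _ _ n
  choose x hx using hpts
  classical
  obtain ⟨m, m', hmm, htype⟩ := Finite.exists_ne_map_eq_of_infinite
    fun (m : ℕ) (j : Fin K) => decide (∀ᶠ n in atTop, x m ∉ L j (f n))
  have hnot : ∀ᶠ n in atTop, ∀ j, ¬ (x m ∈ L j (f n) ∧ x m' ∈ U j (f n)) := by
    refine eventually_all.2 fun j => ?_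
    by_cases hj : ∀ᶠ n in atTop, x m ∉ L j (f n)
    · exact hj.mono fun n hn h => hn h.1
    · have hj' : ¬ ∀ᶠ n in atTop, x m' ∉ L j (f n) := by
        have := congrFun htype j
        simp only [decide_eq_decide] at this
        rwa [← this]
      exact ((hfx j (Finset.mem_univ j) (x m')).resolve_left hj').mono fun n hn h => hn h.2
  obtain ⟨N, hN⟩ := eventually_atTop.1 hnot
  -- `Nat.pair m N` lies in class `m`, not in class `m'`, and is at least `N`.
  obtain ⟨j, hj⟩ := hsepw (f (Nat.pair m N)) (x m) (x m') (by rw [hx]; simp)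
    (by rw [hx]; simpa using hmm)
  exact hN _ (Nat.right_le_pair m N) j hj

/-- `βℕ` is not WRN (whatever the universe in which the Banach spaces live). -/
theorem mainTheorem12 : ¬ IsWRN.{0, v} (StoneCech ℕ) := by
  rintro ⟨V, _, _, _, hV, α, hα⟩
  obtain ⟨e, he, hsurj⟩ := exists_continuous_surjective_stoneCech_nat
  have : Uncountable (ℕ → Bool) := by
    refine not_countable_iff.1 fun _ => ?_
    obtain ⟨s, hs⟩ := exists_surjective_nat (ℕ → Bool)
    obtain ⟨n, hn⟩ := hs fun n => !s n n
    simpa using congrFun hn n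
  exact not_injective_weakDual_of_surjective hV he hsurj hα.continuous hα.injective
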